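/- Let $N\ge 1$ and let $\Omega\subset\mathbb R^N$ be a bounded domain (a nonempty, connected, bounded open set). Put $$c_N=\pi^{-N/2}\,\Gamma(N/2),\qquad \rho_N=2\ln 2+\psi(N/2)-\gamma,\qquad k(z)=\frac{\mathbf 1_{B_1}(z)}{|z|^N},\qquad j(z)=\frac{\mathbf 1_{\mathbb R^N\setminus B_1}(z)}{|z|^N},$$ where $\psi=\Gamma'/\Gamma$, $\gamma$ is the Euler--Mascheroni constant and $B_1$ is the open unit ball. Let $$\mathbb H(\Omega)=\Big\{u\in L^2(\mathbb R^N):\ u=0 \text{ a.e. in }\mathbb R^N\setminus\Omega,\ \iint_{\mathbb R^{2N}}|u(x)-u(y)|^2\,k(x-y)\,dx\,dy<\infty\Big\}$$ with the inner product $\mathcal E(u,v)=\frac{c_N}{2}\iint_{\mathbb R^{2N}}(u(x)-u(y))(v(x)-v(y))\,k(x-y)\,dx\,dy$ and the norm $\|u\|=\mathcal E(u,u)^{1/2}$, and let $$\mathcal E_L(u,v)=\mathcal E(u,v)-c_N\iint_{\mathbb R^{2N}}u(x)v(y)\,j(x-y)\,dx\,dy+\rho_N\int_{\mathbb R^N}uv\,dx$$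 be the quadratic form of the logarithmic Laplacian $L_\Delta$. Let $\mathcal P=\{u\in\mathbb H(\Omega):\int_\Omega u^2\,dx=1\}$, and let $\lambda_1^L=\inf_{u\in\mathcal P}\mathcal E_L(u,u)$ be the first eigenvalue. Let $\varphi_1\in\mathcal P$ be a nonnegative first eigenfunction, that is, $\varphi_1\ge 0$ a.e. and $\mathcal E_L(\varphi_1,v)=\lambda_1^L\int_\Omega\varphi_1v\,dx$ for all $v\in\mathbb H(\Omega)$. For $r\ge 0$ and $u\in\mathbb H(\Omega)$ let $$E_r(u)=\mathcal E_L(u,u)-r\int_\Omega (u^+)^2\,dx,\qquad u^+=\max\{u,0\},$$ and $$c(r)=\inf_{\gamma\in\Gamma}\ \max_{u\in\gamma[-1,1]}E_r(u),\qquad \Gamma=\{\gamma\in C([-1,1],\mathcal P):\ \gamma(-1)=-\varphi_1,\ \gamma(1)=\varphi_1\},$$ where $\mathcal P$ carries the topology of the norm $\|\cdot\|$. Then these quantities are well defined: $\lambda_1^L$ is finite and is the minimum of $\mathcal E_L(u,u)$ over $\mathcal P$, and for every $r\ge 0$ the maximum of $E_r$ on $\gamma[-1,1]$ exists for each $\gamma\in\Gamma$,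 the set $\Gamma$ is nonempty, and the infimum $c(r)$ is finite. Moreover $$\lim_{r\to+\infty}c(r)=\lambda_1^L .$$ -/

import Mathlib

open MeasureTheory Filter Topology Set

noncomputable section

namespace LogLaplacian

/-- The constant `c_N = π^(-N/2) Γ(N/2)`. -/
def cConst (N : ℕ) : ℝ := Real.pi ^ (-(N : ℝ) / 2) * Real.Gamma ((N : ℝ) / 2)

/-- The real digamma function `ψ = Γ' / Γ`. -/
def realDigamma (x : ℝ) : ℝ := deriv Real.Gamma x / Real.Gamma x

/-- The constant `ρ_N = 2 ln 2 + ψ(N/2) - γ`, with `γ` the Euler-Mascheroni constant. -/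
def rhoConst (N : ℕ) : ℝ :=
  2 * Real.log 2 + realDigamma ((N : ℝ) / 2) - Real.eulerMascheroniConstant

/-- The kernel `k(z) = 1_{B_1}(z) / |z|^N`. -/
def kerK {N : ℕ} (z : EuclideanSpace ℝ (Fin N)) : ℝ :=
  (Metric.ball (0 : EuclideanSpace ℝ (Fin N)) 1).indicator (fun w => 1 / ‖w‖ ^ N) z

/-- The kernel `j(z) = 1_{ℝ^N ∖ B_1}(z) / |z|^N`. -/
def kerJ {N : ℕ} (z : EuclideanSpace ℝ (Fin N)) : ℝ :=
  (Metric.ball (0 : EuclideanSpace ℝ (Fin N)) 1)ᶜ.indicator (fun w => 1 / ‖w‖ ^ N) z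

/-- The energy space `ℍ(Ω)`: functions in `L²`, vanishing (almost everywhere) outside `Ω`, with
`∬ |u(x) - u(y)|² k(x - y) dx dy < ∞`. Functions are not identified here when they agree almost
everywhere; every notion below depends on them only up to null sets. -/
def EnergySpace {N : ℕ} (Ω : Set (EuclideanSpace ℝ (Fin N))) :
    Set (EuclideanSpace ℝ (Fin N) → ℝ) :=
  {u | MemLp u 2 volume ∧ (∀ᵐ x ∂volume, x ∉ Ω → u x = 0) ∧
    Integrable (fun p : EuclideanSpace ℝ (Fin N) × EuclideanSpace ℝ (Fin N) =>
      |u p.1 - u p.2| ^ 2 * kerK (p.1 - p.2)) (volume.prod volume)}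

/-- The inner product `𝓔(u, v)` of the energy space. -/
def energy {N : ℕ} (u v : EuclideanSpace ℝ (Fin N) → ℝ) : ℝ :=
  cConst N / 2 * ∫ p : EuclideanSpace ℝ (Fin N) × EuclideanSpace ℝ (Fin N),
    (u p.1 - u p.2) * (v p.1 - v p.2) * kerK (p.1 - p.2) ∂(volume.prod volume)

/-- The norm `‖u‖ = 𝓔(u, u)^(1/2)` of the energy space. -/
def energyNorm {N : ℕ} (u : EuclideanSpace ℝ (Fin N) → ℝ) : ℝ := Real.sqrt (energy u u)

/-- The quadratic form `𝓔_L(u, v)` of the logarithmic Laplacian. -/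
def logForm {N : ℕ} (u v : EuclideanSpace ℝ (Fin N) → ℝ) : ℝ :=
  energy u v
    - cConst N * (∫ p : EuclideanSpace ℝ (Fin N) × EuclideanSpace ℝ (Fin N),
        u p.1 * v p.2 * kerJ (p.1 - p.2) ∂(volume.prod volume))
    + rhoConst N * ∫ x, u x * v x

/-- The constraint set `𝓟 = {u ∈ ℍ(Ω) : ∫_Ω u² = 1}`. -/
def unitSphere {N : ℕ} (Ω : Set (EuclideanSpace ℝ (Fin N))) :
    Set (EuclideanSpace ℝ (Fin N) → ℝ) :=
  {u | u ∈ EnergySpace Ω ∧ ∫ x in Ω, u x ^ 2 = 1}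

/-- The first eigenvalue `λ₁ = inf {𝓔_L(u, u) : u ∈ ℍ(Ω), ‖u‖₂ = 1}`. -/
def firstEigenvalue {N : ℕ} (Ω : Set (EuclideanSpace ℝ (Fin N))) : ℝ :=
  sInf ((fun u => logForm u u) '' unitSphere Ω)

/-- `φ` is an `L²`-normalised nonnegative first eigenfunction: a nonnegative `φ ∈ 𝓟` which is a
weak solution of `L_Δ φ = λ₁ φ` in `Ω`, `φ = 0` outside `Ω`. -/
def IsFirstEigenfunction {N : ℕ} (Ω : Set (EuclideanSpace ℝ (Fin N)))
    (φ : EuclideanSpace ℝ (Fin N) → ℝ) : Prop :=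
  φ ∈ unitSphere Ω ∧ (∀ᵐ x ∂volume, 0 ≤ φ x) ∧
    ∀ v ∈ EnergySpace Ω, logForm φ v = firstEigenvalue Ω * ∫ x in Ω, φ x * v x

/-- The functional `E_r(u) = 𝓔_L(u, u) - r ∫_Ω (u⁺)²`. -/
def functionalE {N : ℕ} (Ω : Set (EuclideanSpace ℝ (Fin N))) (r : ℝ)
    (u : EuclideanSpace ℝ (Fin N) → ℝ) : ℝ :=
  logForm u u - r * ∫ x in Ω, (max (u x) 0) ^ 2

/-- The set `Γ` of paths `γ ∈ C([-1, 1], 𝓟)` from `-φ` to `φ`, continuous for the norm of `ℍ(Ω)`.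
A path is a map on `ℝ` of which only the values on `[-1, 1]` matter. -/
def paths {N : ℕ} (Ω : Set (EuclideanSpace ℝ (Fin N)))
    (φ : EuclideanSpace ℝ (Fin N) → ℝ) : Set (ℝ → EuclideanSpace ℝ (Fin N) → ℝ) :=
  {γ | (∀ t ∈ Icc (-1 : ℝ) 1, γ t ∈ unitSphere Ω) ∧
    (∀ t ∈ Icc (-1 : ℝ) 1,
      Tendsto (fun s => energyNorm (γ s - γ t)) (𝓝[Icc (-1 : ℝ) 1] t) (𝓝 0)) ∧
    γ (-1) =ᵐ[volume] -φ ∧ γ 1 =ᵐ[volume] φ}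

/-- The set of the values of `E_r` along `γ[-1, 1]`. -/
def pathValues {N : ℕ} (Ω : Set (EuclideanSpace ℝ (Fin N))) (r : ℝ)
    (γ : ℝ → EuclideanSpace ℝ (Fin N) → ℝ) : Set ℝ :=
  (fun t => functionalE Ω r (γ t)) '' Icc (-1 : ℝ) 1

/-- The set of the numbers `max {E_r(u) : u ∈ γ[-1, 1]}`, `γ ∈ Γ`. -/
def pathMaxima {N : ℕ} (Ω : Set (EuclideanSpace ℝ (Fin N)))
    (φ : EuclideanSpace ℝ (Fin N) → ℝ) (r : ℝ) : Set ℝ :=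
  {m | ∃ γ ∈ paths Ω φ, IsGreatest (pathValues Ω r γ) m}

/-- The minimax level `c(r) = inf_{γ ∈ Γ} max_{u ∈ γ[-1, 1]} E_r(u)`. -/
def minimaxLevel {N : ℕ} (Ω : Set (EuclideanSpace ℝ (Fin N)))
    (φ : EuclideanSpace ℝ (Fin N) → ℝ) (r : ℝ) : ℝ :=
  sInf (pathMaxima Ω φ r)

end LogLaplacian

end

/-! Lower bound: every path starts at `-φ`, whose positive part vanishes, so `E_r` takes the value
`λ₁` there for every `r`. Hence `c(r) ≥ λ₁` (`firstEigenvalue_le_of_mem_pathMaxima`).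

Upper bound: for each `ε > 0`, one path independent of `r` has maximum at most `λ₁ + ε` once `r` is
large. A path from `-φ` to `φ` is harmless wherever its positive part is nonzero, since a large `r`
pushes `E_r` down there; the only difficulty is to leave the functions `≤ 0` cheaply. The
logarithmic kernel gives points zero capacity, so there is `ψ ≥ 0` of tiny energy with `ψ ≤ φ` false
on a set of positive measure (`exists_small_not_le`). Moving from `-φ` to `ψ - φ` then raises the
quadratic form by at most `ε`, because the eigenvalue equation removes the mixed term. From `ψ - φ`
to `φ` the positive part never vanishes (`exists_path`), and by compactness its `L²` norm stays away
from zero (`exists_mem_pathMaxima_le`).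

Existence of the maxima and this compactness argument require both parts of `E_r` to be continuous
along paths in the energy norm. That rests on a Poincaré inequality (`exists_poincare`), which makes
the lower-order terms of the form subordinate to the energy. -/

namespace LogLaplacian

variable {N : ℕ} {Ω : Set (EuclideanSpace ℝ (Fin N))}
  {u v w φ ψ : EuclideanSpace ℝ (Fin N) → ℝ}

/-! ### Kernels, the energy space and its bilinear forms -/

theorem cConst_pos (hN : 1 ≤ N) : 0 < cConst N := by
  have : (0 : ℝ) < N := by exact_mod_cast hN
  exact mul_pos (Real.rpow_pos_of_pos Real.pi_pos _) (Real.Gamma_pos_of_pos (by positivity))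

theorem kerK_nonneg (z : EuclideanSpace ℝ (Fin N)) : 0 ≤ kerK z :=
  indicator_nonneg (fun _ _ => by positivity) z

theorem kerJ_nonneg (z : EuclideanSpace ℝ (Fin N)) : 0 ≤ kerJ z :=
  indicator_nonneg (fun _ _ => by positivity) z

theorem kerJ_le_one (z : EuclideanSpace ℝ (Fin N)) : kerJ z ≤ 1 := by
  refine indicator_le' (g := fun _ => (1 : ℝ)) (fun w hw => ?_) (fun _ _ => zero_le_one) z
  have h1 : 1 ≤ ‖w‖ := by simpa using hw
  exact div_le_one_of_le₀ (one_le_pow₀ h1) (by positivity)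

theorem one_le_kerK {z : EuclideanSpace ℝ (Fin N)} (h0 : 0 < ‖z‖) (h1 : ‖z‖ < 1) :
    1 ≤ kerK z := by
  rw [kerK, indicator_of_mem (by simpa using h1), one_le_div (by positivity)]
  exact pow_le_one₀ h0.le h1.le

theorem kerJ_neg (z : EuclideanSpace ℝ (Fin N)) : kerJ (-z) = kerJ z := by
  simp [kerJ, indicator]

theorem measurable_kerK : Measurable (kerK (N := N)) :=
  Measurable.indicator (by fun_prop) Metric.isOpen_ball.measurableSet

theorem measurable_kerJ : Measurable (kerJ (N := N)) :=
  Measurable.indicator (by fun_prop) Metric.isOpen_ball.measurableSet.compl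

theorem aestronglyMeasurable_kerK_sub :
    AEStronglyMeasurable (fun p : EuclideanSpace ℝ (Fin N) × EuclideanSpace ℝ (Fin N) =>
      kerK (p.1 - p.2)) (volume.prod volume) :=
  (measurable_kerK.comp (measurable_fst.sub measurable_snd)).aestronglyMeasurable

theorem aestronglyMeasurable_kerJ_sub :
    AEStronglyMeasurable (fun p : EuclideanSpace ℝ (Fin N) × EuclideanSpace ℝ (Fin N) =>
      kerJ (p.1 - p.2)) (volume.prod volume) :=
  (measurable_kerJ.comp (measurable_fst.sub measurable_snd)).aestronglyMeasurable

theorem aestronglyMeasurable_sub_prod (hu : AEStronglyMeasurable u volume) :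
    AEStronglyMeasurable (fun p : EuclideanSpace ℝ (Fin N) × EuclideanSpace ℝ (Fin N) =>
      u p.1 - u p.2) (volume.prod volume) :=
  hu.comp_fst.sub hu.comp_snd

theorem integrable_energy (hu : u ∈ EnergySpace Ω) (hv : v ∈ EnergySpace Ω) :
    Integrable (fun p : EuclideanSpace ℝ (Fin N) × EuclideanSpace ℝ (Fin N) =>
      (u p.1 - u p.2) * (v p.1 - v p.2) * kerK (p.1 - p.2)) (volume.prod volume) := by
  refine (hu.2.2.add hv.2.2).mono'
    (((aestronglyMeasurable_sub_prod hu.1.1).mul (aestronglyMeasurable_sub_prod hv.1.1)).mul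
      aestronglyMeasurable_kerK_sub) (Eventually.of_forall fun p => ?_)
  have hk := kerK_nonneg (p.1 - p.2)
  simp only [Real.norm_eq_abs, abs_mul, abs_of_nonneg hk, Pi.add_apply, ← add_mul]
  gcongr
  nlinarith [sq_nonneg (|u p.1 - u p.2| - |v p.1 - v p.2|), sq_nonneg (|u p.1 - u p.2|),
    sq_nonneg (|v p.1 - v p.2|)]

/-- On a set of finite measure `L²` embeds in `L¹`. The closure of `Ω` stands in for `Ω` because it
is always measurable. -/
theorem integrable_of_mem_energySpace (hΩ : Bornology.IsBounded Ω) (hu : u ∈ EnergySpace Ω) :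
    Integrable u volume := by
  have hfin : volume (closure Ω) < ⊤ := hΩ.isCompact_closure.measure_lt_top
  have : IsFiniteMeasure (volume.restrict (closure Ω)) := ⟨by simpa using hfin⟩
  have h1 : IntegrableOn u (closure Ω) :=
    (hu.1.restrict (closure Ω)).integrable (by norm_num)
  have h2 : Integrable ((closure Ω).indicator u) :=
    h1.integrable_indicator isClosed_closure.measurableSet
  refine h2.congr ?_
  filter_upwards [hu.2.1] with x hx
  by_cases h : x ∈ closure Ω
  · simp [h]
  · simp [h, hx fun h' => h (subset_closure h')]

theorem integrable_mul_of_mem_energySpace (hu : u ∈ EnergySpace Ω) (hv : v ∈ EnergySpace Ω) :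
    Integrable (fun x => u x * v x) volume :=
  hu.1.integrable_mul hv.1

theorem integrable_sq_of_mem_energySpace (hu : u ∈ EnergySpace Ω) :
    Integrable (fun x => u x ^ 2) volume :=
  hu.1.integrable_sq

theorem integrable_interaction (hΩ : Bornology.IsBounded Ω) (hu : u ∈ EnergySpace Ω)
    (hv : v ∈ EnergySpace Ω) :
    Integrable (fun p : EuclideanSpace ℝ (Fin N) × EuclideanSpace ℝ (Fin N) =>
      u p.1 * v p.2 * kerJ (p.1 - p.2)) (volume.prod volume) := by
  have h := (integrable_of_mem_energySpace hΩ hu).mul_prod (integrable_of_mem_energySpace hΩ hv)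
  refine h.mono (h.1.mul aestronglyMeasurable_kerJ_sub) (Eventually.of_forall fun p => ?_)
  rw [norm_mul, Real.norm_of_nonneg (kerJ_nonneg _)]
  exact mul_le_of_le_one_right (norm_nonneg _) (kerJ_le_one _)

theorem add_smul_mem_energySpace (a b : ℝ) (hu : u ∈ EnergySpace Ω) (hv : v ∈ EnergySpace Ω) :
    a • u + b • v ∈ EnergySpace Ω := by
  refine ⟨(hu.1.const_smul a).add (hv.1.const_smul b), ?_, ?_⟩
  · filter_upwards [hu.2.1, hv.2.1] with x h1 h2 hx
    simp [h1 hx, h2 hx]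
  · have h := ((hu.2.2.const_mul (a ^ 2)).add ((integrable_energy hu hv).const_mul (2 * a * b))).add
      (hv.2.2.const_mul (b ^ 2))
    refine h.congr (Eventually.of_forall fun p => ?_)
    simp only [sq_abs, Pi.add_apply, Pi.smul_apply, smul_eq_mul]
    ring

theorem smul_mem_energySpace (a : ℝ) (hu : u ∈ EnergySpace Ω) : a • u ∈ EnergySpace Ω := by
  simpa using add_smul_mem_energySpace a 0 hu hu

theorem sub_mem_energySpace (hu : u ∈ EnergySpace Ω) (hv : v ∈ EnergySpace Ω) :
    u - v ∈ EnergySpace Ω := by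
  simpa [sub_eq_add_neg] using add_smul_mem_energySpace 1 (-1) hu hv

theorem energy_add_smul_left (a b : ℝ) (hu : u ∈ EnergySpace Ω) (hv : v ∈ EnergySpace Ω)
    (hw : w ∈ EnergySpace Ω) :
    energy (a • u + b • v) w = a * energy u w + b * energy v w := by
  have h : ∀ p : EuclideanSpace ℝ (Fin N) × EuclideanSpace ℝ (Fin N),
      ((a • u + b • v) p.1 - (a • u + b • v) p.2) * (w p.1 - w p.2) * kerK (p.1 - p.2) =
      a * ((u p.1 - u p.2) * (w p.1 - w p.2) * kerK (p.1 - p.2)) +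
      b * ((v p.1 - v p.2) * (w p.1 - w p.2) * kerK (p.1 - p.2)) := fun p => by
    simp only [Pi.add_apply, Pi.smul_apply, smul_eq_mul]; ring
  simp only [energy, h]
  rw [integral_add ((integrable_energy hu hw).const_mul a) ((integrable_energy hv hw).const_mul b),
    integral_const_mul, integral_const_mul]
  ring

theorem energy_comm (u v : EuclideanSpace ℝ (Fin N) → ℝ) : energy u v = energy v u := by
  simp only [energy, mul_comm (u _ - u _)]

theorem energy_nonneg (u : EuclideanSpace ℝ (Fin N) → ℝ) : 0 ≤ energy u u := by
  rcases Nat.eq_zero_or_pos N with rfl | hN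
  · refine mul_nonneg ?_ (integral_nonneg fun p => ?_)
    -- In dimension zero the constant vanishes, since `Real.Gamma 0` is `0` by convention.
    · simp [cConst]
    · exact mul_nonneg (mul_self_nonneg _) (kerK_nonneg _)
  · exact mul_nonneg (by have := cConst_pos hN; positivity)
      (integral_nonneg fun p => mul_nonneg (mul_self_nonneg _) (kerK_nonneg _))

theorem energy_add_smul_self (a b : ℝ) (hu : u ∈ EnergySpace Ω) (hv : v ∈ EnergySpace Ω) :
    energy (a • u + b • v) (a • u + b • v) =
      a ^ 2 * energy u u + 2 * a * b * energy u v + b ^ 2 * energy v v := by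
  have hw := add_smul_mem_energySpace a b hu hv
  rw [energy_add_smul_left a b hu hv hw, energy_comm u, energy_comm v,
    energy_add_smul_left a b hu hv hu, energy_add_smul_left a b hu hv hv, energy_comm v u]
  ring

theorem logForm_comm (u v : EuclideanSpace ℝ (Fin N) → ℝ) : logForm u v = logForm v u := by
  have h := integral_prod_swap (μ := (volume : Measure (EuclideanSpace ℝ (Fin N))))
    (ν := (volume : Measure (EuclideanSpace ℝ (Fin N))))
    (fun p : EuclideanSpace ℝ (Fin N) × EuclideanSpace ℝ (Fin N) =>
      u p.1 * v p.2 * kerJ (p.1 - p.2))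
  have h' : ∀ p : EuclideanSpace ℝ (Fin N) × EuclideanSpace ℝ (Fin N),
      u p.swap.1 * v p.swap.2 * kerJ (p.swap.1 - p.swap.2) =
      v p.1 * u p.2 * kerJ (p.1 - p.2) := fun p => by
    rw [Prod.fst_swap, Prod.snd_swap, ← kerJ_neg, neg_sub, mul_comm (u _)]
  simp only [h'] at h
  simp only [logForm, energy_comm u v, h, mul_comm (u _) (v _)]

theorem logForm_add_smul_left (hΩ : Bornology.IsBounded Ω) (a b : ℝ) (hu : u ∈ EnergySpace Ω)
    (hv : v ∈ EnergySpace Ω) (hw : w ∈ EnergySpace Ω) :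
    logForm (a • u + b • v) w = a * logForm u w + b * logForm v w := by
  have h : ∀ p : EuclideanSpace ℝ (Fin N) × EuclideanSpace ℝ (Fin N),
      (a • u + b • v) p.1 * w p.2 * kerJ (p.1 - p.2) =
      a * (u p.1 * w p.2 * kerJ (p.1 - p.2)) + b * (v p.1 * w p.2 * kerJ (p.1 - p.2)) :=
    fun p => by simp only [Pi.add_apply, Pi.smul_apply, smul_eq_mul]; ring
  have h' : ∀ x, (a • u + b • v) x * w x = a * (u x * w x) + b * (v x * w x) :=
    fun x => by simp only [Pi.add_apply, Pi.smul_apply, smul_eq_mul]; ring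
  simp only [logForm, h, h', energy_add_smul_left a b hu hv hw]
  rw [integral_add ((integrable_interaction hΩ hu hw).const_mul a)
      ((integrable_interaction hΩ hv hw).const_mul b),
    integral_add ((integrable_mul_of_mem_energySpace hu hw).const_mul a)
      ((integrable_mul_of_mem_energySpace hv hw).const_mul b)]
  simp only [integral_const_mul]
  ring

theorem logForm_add_smul_self (hΩ : Bornology.IsBounded Ω) (a b : ℝ) (hu : u ∈ EnergySpace Ω)
    (hv : v ∈ EnergySpace Ω) :
    logForm (a • u + b • v) (a • u + b • v) =
      a ^ 2 * logForm u u + 2 * a * b * logForm u v + b ^ 2 * logForm v v := by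
  have hw := add_smul_mem_energySpace a b hu hv
  rw [logForm_add_smul_left hΩ a b hu hv hw, logForm_comm u, logForm_comm v,
    logForm_add_smul_left hΩ a b hu hv hu, logForm_add_smul_left hΩ a b hu hv hv, logForm_comm v u]
  ring

theorem setIntegral_mul_eq (f : EuclideanSpace ℝ (Fin N) → ℝ) (hu : u ∈ EnergySpace Ω) :
    ∫ x in Ω, u x * f x = ∫ x, u x * f x :=
  setIntegral_eq_integral_of_ae_compl_eq_zero (by
    filter_upwards [hu.2.1] with x hx h
    simp [hx h])

theorem setIntegral_sq_eq (hu : u ∈ EnergySpace Ω) : ∫ x in Ω, u x ^ 2 = ∫ x, u x ^ 2 := by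
  simpa only [sq] using setIntegral_mul_eq u hu

theorem integral_sq_add_smul (a b : ℝ) (hu : u ∈ EnergySpace Ω) (hv : v ∈ EnergySpace Ω) :
    ∫ x, (a • u + b • v) x ^ 2 =
      a ^ 2 * (∫ x, u x ^ 2) + 2 * a * b * (∫ x, u x * v x) + b ^ 2 * ∫ x, v x ^ 2 := by
  have h : ∀ x, (a • u + b • v) x ^ 2 =
      a ^ 2 * u x ^ 2 + 2 * a * b * (u x * v x) + b ^ 2 * v x ^ 2 :=
    fun x => by simp only [Pi.add_apply, Pi.smul_apply, smul_eq_mul]; ring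
  simp only [h]
  have h1 := (integrable_sq_of_mem_energySpace hu).const_mul (a ^ 2)
  have h2 := (integrable_mul_of_mem_energySpace hu hv).const_mul (2 * a * b)
  have h3 := (integrable_sq_of_mem_energySpace hv).const_mul (b ^ 2)
  rw [integral_add (f := fun x => a ^ 2 * u x ^ 2 + 2 * a * b * (u x * v x)) (h1.add h2) h3,
    integral_add h1 h2]
  simp only [integral_const_mul]

/-- `|∬ u(x) u(y) j(x - y)| ≤ |Ω| ∫ u²`. -/
theorem abs_interaction_le (hΩ : Bornology.IsBounded Ω) (hu : u ∈ EnergySpace Ω) :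
    |∫ p : EuclideanSpace ℝ (Fin N) × EuclideanSpace ℝ (Fin N),
      u p.1 * u p.2 * kerJ (p.1 - p.2) ∂(volume.prod volume)| ≤
      (volume (closure Ω)).toReal * ∫ x, u x ^ 2 := by
  have hint := (integrable_of_mem_energySpace hΩ hu).norm
  have h1 : |∫ p : EuclideanSpace ℝ (Fin N) × EuclideanSpace ℝ (Fin N),
      u p.1 * u p.2 * kerJ (p.1 - p.2) ∂(volume.prod volume)| ≤ (∫ x, ‖u x‖) * ∫ x, ‖u x‖ := by
    rw [← integral_prod_mul, ← Real.norm_eq_abs]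
    refine norm_integral_le_of_norm_le (hint.mul_prod hint) (Eventually.of_forall fun p => ?_)
    rw [norm_mul, norm_mul, Real.norm_of_nonneg (kerJ_nonneg _)]
    exact mul_le_of_le_one_right (by positivity) (kerJ_le_one _)
  refine h1.trans ?_
  have hfin : volume (closure Ω) < ⊤ := hΩ.isCompact_closure.measure_lt_top
  have h2 : ∫ x, ‖u x‖ = ∫ x, ‖u x‖ * (closure Ω).indicator 1 x := by
    refine integral_congr_ae ?_
    filter_upwards [hu.2.1] with x hx
    by_cases h : x ∈ closure Ω
    · simp [h]
    · simp [h, hx fun h' => h (subset_closure h')]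
  have hm : MemLp ((closure Ω).indicator (1 : EuclideanSpace ℝ (Fin N) → ℝ)) 2 volume :=
    memLp_indicator_const 2 isClosed_closure.measurableSet (1 : ℝ) (Or.inr hfin.ne)
  have h3 := integral_mul_le_Lp_mul_Lq_of_nonneg (μ := (volume : Measure (EuclideanSpace ℝ (Fin N))))
    Real.HolderConjugate.two_two
    (f := fun x => ‖u x‖) (g := (closure Ω).indicator (1 : EuclideanSpace ℝ (Fin N) → ℝ))
    (Eventually.of_forall fun x => norm_nonneg _)
    (Eventually.of_forall fun x => indicator_nonneg (fun _ _ => zero_le_one) x)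
    (by simpa using hu.1.norm) (by simpa using hm)
  have h4 : ∫ x, (closure Ω).indicator (1 : EuclideanSpace ℝ (Fin N) → ℝ) x ^ (2 : ℝ) =
      (volume (closure Ω)).toReal := by
    have : ∀ x, (closure Ω).indicator (1 : EuclideanSpace ℝ (Fin N) → ℝ) x ^ (2 : ℝ) =
        (closure Ω).indicator 1 x := fun x => by
      by_cases h : x ∈ closure Ω <;> simp [h]
    simp only [this]
    rw [integral_indicator_one isClosed_closure.measurableSet, Measure.real]
  rw [← h2, h4] at h3
  simp only [Real.rpow_two, Real.norm_eq_abs, sq_abs] at h3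
  rw [← Real.sqrt_eq_rpow, ← Real.sqrt_eq_rpow] at h3
  have h0 : 0 ≤ ∫ x, ‖u x‖ := integral_nonneg fun x => norm_nonneg _
  have h5 : 0 ≤ ∫ x, u x ^ 2 := integral_nonneg fun x => sq_nonneg _
  simp only [Real.norm_eq_abs] at h0 ⊢
  calc _ ≤ (√(∫ x, u x ^ 2) * √(volume (closure Ω)).toReal) *
        (√(∫ x, u x ^ 2) * √(volume (closure Ω)).toReal) := by gcongr
    _ = _ := by
      rw [mul_mul_mul_comm, Real.mul_self_sqrt h5, Real.mul_self_sqrt ENNReal.toReal_nonneg,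
        mul_comm]

/-! ### The Poincaré inequality -/

theorem sq_telescope_le (f : ℕ → ℝ) (n : ℕ) (hf : f n = 0) :
    f 0 ^ 2 ≤ n * ∑ i ∈ Finset.range n, (f i - f (i + 1)) ^ 2 := by
  have h := sq_sum_le_card_mul_sum_sq (s := Finset.range n) (f := fun i => f i - f (i + 1))
  rwa [Finset.sum_range_sub', hf, sub_zero, Finset.card_range] at h

/-- A function vanishing outside a set of diameter less than `n ‖h‖` is controlled in `L²` by its
difference with its translate by `h`. -/
theorem lintegral_sq_le_translate {W : EuclideanSpace ℝ (Fin N) → ℝ} (hW : Measurable W) {n : ℕ}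
    (h : EuclideanSpace ℝ (Fin N)) (hΩ : ∀ x ∈ Ω, x - (n : ℝ) • h ∉ Ω)
    (hW0 : ∀ x, x ∉ Ω → W x = 0) :
    ∫⁻ x, ENNReal.ofReal (W x ^ 2) ≤
      (n : ENNReal) ^ 2 * ∫⁻ x, ENNReal.ofReal ((W x - W (x - h)) ^ 2) := by
  have hm : Measurable fun x => ENNReal.ofReal ((W x - W (x - h)) ^ 2) := by fun_prop
  have hpt : ∀ x, ENNReal.ofReal (W x ^ 2) ≤ n * ∑ i ∈ Finset.range n,
      ENNReal.ofReal ((W (x - (i : ℝ) • h) - W (x - (i : ℝ) • h - h)) ^ 2) := fun x => by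
    by_cases hx : x ∈ Ω
    -- The chain `x, x - h, ..., x - n h` ends outside `Ω`, where `W` vanishes. After integration
    -- all `n` increments contribute equally, by translation invariance.
    · have h1 := sq_telescope_le (fun i => W (x - (i : ℝ) • h)) n (hW0 _ (hΩ x hx))
      have h2 : ∀ i : ℕ, x - ((i + 1 : ℕ) : ℝ) • h = x - (i : ℝ) • h - h := fun i => by
        push_cast; rw [add_smul, one_smul, sub_sub]
      simp only [h2, Nat.cast_zero, zero_smul, sub_zero] at h1
      rw [← ENNReal.ofReal_sum_of_nonneg fun i _ => sq_nonneg _, ← ENNReal.ofReal_natCast,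
        ← ENNReal.ofReal_mul (by positivity)]
      exact ENNReal.ofReal_le_ofReal h1
    · simp [hW0 x hx]
  calc ∫⁻ x, ENNReal.ofReal (W x ^ 2) ≤ ∫⁻ x, n * ∑ i ∈ Finset.range n,
      ENNReal.ofReal ((W (x - (i : ℝ) • h) - W (x - (i : ℝ) • h - h)) ^ 2) := lintegral_mono hpt
    _ = n * ∑ i ∈ Finset.range n,
        ∫⁻ x, ENNReal.ofReal ((W (x - (i : ℝ) • h) - W (x - (i : ℝ) • h - h)) ^ 2) := by
      rw [lintegral_const_mul _ (by fun_prop), lintegral_finsetSum _ (fun i _ => by fun_prop)]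
    _ = n * ∑ i ∈ Finset.range n, ∫⁻ x, ENNReal.ofReal ((W x - W (x - h)) ^ 2) := by
      congr 1
      refine Finset.sum_congr rfl fun i _ => ?_
      exact lintegral_sub_right_eq_self
        (fun x => ENNReal.ofReal ((W x - W (x - h)) ^ 2)) ((i : ℝ) • h)
    _ = _ := by
      rw [Finset.sum_const, Finset.card_range, nsmul_eq_mul, sq, mul_assoc]

theorem lintegral_translate_eq {W : EuclideanSpace ℝ (Fin N) → ℝ} (hW : Measurable W) :
    ∫⁻ h, ∫⁻ x, ENNReal.ofReal ((W x - W (x - h)) ^ 2 * kerK h) =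
      ∫⁻ p : EuclideanSpace ℝ (Fin N) × EuclideanSpace ℝ (Fin N),
        ENNReal.ofReal ((W p.1 - W p.2) ^ 2 * kerK (p.1 - p.2)) ∂(volume.prod volume) := by
  have hk := measurable_kerK (N := N)
  rw [lintegral_lintegral_swap (by fun_prop), lintegral_prod _ (by fun_prop)]
  refine lintegral_congr fun x => ?_
  rw [← lintegral_sub_left_eq_self _ x]
  simp

/-- The translation estimate is averaged over shifts in the annulus `1/2 < ‖h‖ < 1`, where `k ≥ 1`,
so the average is controlled by the energy. No compact embedding is needed. -/
theorem exists_poincare (hN : 1 ≤ N) (hΩ : Bornology.IsBounded Ω) :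
    ∃ C : ℝ, 0 ≤ C ∧ ∀ u ∈ EnergySpace Ω, ∫ x, u x ^ 2 ≤ C * energy u u := by
  have : Nonempty (Fin N) := ⟨⟨0, hN⟩⟩
  have : Nontrivial (EuclideanSpace ℝ (Fin N)) := inferInstance
  obtain ⟨D, hD⟩ := Metric.isBounded_iff.1 hΩ
  -- Shifts in the annulus are longer than `1/2`, so `n` of them cover more than the diameter bound
  -- `D`.
  obtain ⟨n, hn⟩ := exists_nat_gt (2 * D)
  set A : Set (EuclideanSpace ℝ (Fin N)) := {h | 1 / 2 < ‖h‖ ∧ ‖h‖ < 1} with hA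
  have hAo : IsOpen A :=
    (isOpen_lt continuous_const continuous_norm).inter (isOpen_lt continuous_norm continuous_const)
  obtain ⟨e, he⟩ := exists_norm_eq (EuclideanSpace ℝ (Fin N)) (c := 3 / 4) (by norm_num)
  have hA0 : volume A ≠ 0 := (hAo.measure_pos _ ⟨e, by rw [he]; norm_num, by rw [he]; norm_num⟩).ne'
  have hA1 : volume A ≠ ⊤ := ((measure_mono fun h hh => by simpa using hh.2).trans_lt
    (measure_ball_lt_top (x := (0 : EuclideanSpace ℝ (Fin N))) (r := 1))).ne
  have hc := cConst_pos hN
  have hVpos : 0 < (volume A).toReal := ENNReal.toReal_pos hA0 hA1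
  refine ⟨2 * n ^ 2 / (cConst N * (volume A).toReal), by positivity, fun u hu => ?_⟩
  -- A Borel representative that vanishes everywhere, not just almost everywhere, outside `closure
  -- Ω`, as the pointwise telescoping demands.
  set W : EuclideanSpace ℝ (Fin N) → ℝ := (closure Ω).indicator (hu.1.1.mk u) with hWdef
  have hWm : Measurable W :=
    hu.1.1.stronglyMeasurable_mk.measurable.indicator isClosed_closure.measurableSet
  have huW : u =ᵐ[volume] W := by
    filter_upwards [hu.2.1, hu.1.1.ae_eq_mk] with x hx h
    by_cases hx' : x ∈ closure Ω
    · simp [W, hx', h]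
    · simp [W, hx', hx fun h' => hx' (subset_closure h')]
  have hk := measurable_kerK (N := N)
  have hfar : ∀ h ∈ A, ∀ x ∈ closure Ω, x - (n : ℝ) • h ∉ closure Ω := fun h hh x hx hx' => by
    have h1 : dist x (x - (n : ℝ) • h) ≤ D := by
      have := Metric.dist_le_diam_of_mem hΩ.closure hx hx'
      rw [Metric.diam_closure] at this
      refine this.trans (Metric.diam_le_of_forall_dist_le ?_ fun x hx y hy => hD hx hy)
      obtain ⟨y, hy⟩ := closure_nonempty_iff.1 ⟨x, hx⟩
      exact dist_nonneg.trans (hD hy hy)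
    rw [dist_self_sub_right, norm_smul, Real.norm_natCast] at h1
    nlinarith [hh.1, hh.2, (Nat.cast_nonneg n : (0 : ℝ) ≤ n)]
  have key : volume A * ∫⁻ x, ENNReal.ofReal (W x ^ 2) ≤ (n : ENNReal) ^ 2 *
      ∫⁻ p : EuclideanSpace ℝ (Fin N) × EuclideanSpace ℝ (Fin N),
        ENNReal.ofReal ((W p.1 - W p.2) ^ 2 * kerK (p.1 - p.2)) ∂(volume.prod volume) := by
    have hm : Measurable fun h => ∫⁻ x, ENNReal.ofReal ((W x - W (x - h)) ^ 2 * kerK h) :=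
      Measurable.lintegral_prod_right (by fun_prop)
    rw [← lintegral_translate_eq hWm, ← lintegral_const_mul _ hm, mul_comm (volume A),
      ← setLIntegral_const]
    refine (setLIntegral_mono (hm.const_mul _) fun h hh => ?_).trans (setLIntegral_le_lintegral A _)
    refine (lintegral_sq_le_translate hWm h (hfar h hh)
      fun x hx => indicator_of_notMem hx _).trans ?_
    gcongr with x
    exact le_mul_of_one_le_right (sq_nonneg _) (one_le_kerK (by linarith [hh.1]) hh.2)
  have e1 : ENNReal.ofReal (∫ x, u x ^ 2) = ∫⁻ x, ENNReal.ofReal (W x ^ 2) := by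
    rw [ofReal_integral_eq_lintegral_ofReal (integrable_sq_of_mem_energySpace hu)
      (Eventually.of_forall fun x => sq_nonneg _)]
    refine lintegral_congr_ae ?_
    filter_upwards [huW] with x hx
    rw [hx]
  have e2 : ENNReal.ofReal (∫ p : EuclideanSpace ℝ (Fin N) × EuclideanSpace ℝ (Fin N),
      (u p.1 - u p.2) * (u p.1 - u p.2) * kerK (p.1 - p.2) ∂(volume.prod volume)) =
      ∫⁻ p : EuclideanSpace ℝ (Fin N) × EuclideanSpace ℝ (Fin N),
        ENNReal.ofReal ((W p.1 - W p.2) ^ 2 * kerK (p.1 - p.2)) ∂(volume.prod volume) := by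
    rw [ofReal_integral_eq_lintegral_ofReal (integrable_energy hu hu)
      (Eventually.of_forall fun p => mul_nonneg (mul_self_nonneg _) (kerK_nonneg _))]
    refine lintegral_congr_ae ?_
    filter_upwards [Measure.quasiMeasurePreserving_fst.ae_eq_comp huW,
      Measure.quasiMeasurePreserving_snd.ae_eq_comp huW] with p h1 h2
    simp only [Function.comp_apply] at h1 h2
    rw [h1, h2, sq]
  have hI : 0 ≤ ∫ p : EuclideanSpace ℝ (Fin N) × EuclideanSpace ℝ (Fin N),
      (u p.1 - u p.2) * (u p.1 - u p.2) * kerK (p.1 - p.2) ∂(volume.prod volume) :=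
    integral_nonneg fun p => mul_nonneg (mul_self_nonneg _) (kerK_nonneg _)
  rw [← e1, ← e2, ← ENNReal.ofReal_toReal hA1, ← ENNReal.ofReal_natCast,
    ← ENNReal.ofReal_pow (by positivity), ← ENNReal.ofReal_mul (by positivity),
    ← ENNReal.ofReal_mul (by positivity), ENNReal.ofReal_le_ofReal_iff (by positivity)] at key
  rw [energy, div_mul_eq_mul_div, le_div_iff₀ (by positivity)]
  nlinarith [mul_le_mul_of_nonneg_left key hc.le]

/-! ### Control of the form by the energy and continuity along paths -/

theorem exists_abs_logForm_sub_energy_le (hN : 1 ≤ N) (hΩ : Bornology.IsBounded Ω) :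
    ∃ K : ℝ, 0 ≤ K ∧ ∀ u ∈ EnergySpace Ω, |logForm u u - energy u u| ≤ K * ∫ x, u x ^ 2 := by
  have hc := cConst_pos hN
  refine ⟨cConst N * (volume (closure Ω)).toReal + |rhoConst N|, by positivity, fun u hu => ?_⟩
  have h := abs_interaction_le hΩ hu
  have h5 : 0 ≤ ∫ x, u x ^ 2 := integral_nonneg fun x => sq_nonneg _
  simp only [logForm, ← sq] at h ⊢
  set I := ∫ p : EuclideanSpace ℝ (Fin N) × EuclideanSpace ℝ (Fin N),
    u p.1 * u p.2 * kerJ (p.1 - p.2) ∂(volume.prod volume)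
  calc _ = |-(cConst N * I) + rhoConst N * ∫ x, u x ^ 2| := by congr 1; ring
    _ ≤ cConst N * |I| + |rhoConst N| * ∫ x, u x ^ 2 := by
      refine (abs_add_le _ _).trans_eq ?_
      rw [abs_neg, abs_mul, abs_mul, abs_of_pos hc, abs_of_nonneg h5]
    _ ≤ _ := by
      have := mul_le_mul_of_nonneg_left h hc.le
      linarith

theorem exists_abs_logForm_le (hN : 1 ≤ N) (hΩ : Bornology.IsBounded Ω) :
    ∃ C : ℝ, 0 ≤ C ∧ ∀ u ∈ EnergySpace Ω, |logForm u u| ≤ C * energy u u := by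
  obtain ⟨K, hK, h⟩ := exists_abs_logForm_sub_energy_le hN hΩ
  obtain ⟨C, hC, h'⟩ := exists_poincare hN hΩ
  refine ⟨1 + K * C, by positivity, fun u hu => ?_⟩
  have h1 := abs_le.1 (h u hu)
  have h2 := mul_le_mul_of_nonneg_left (h' u hu) hK
  have h3 := energy_nonneg u
  rw [abs_le]
  constructor <;> nlinarith

/-- With `w = u - v` the difference is `logForm w w + 2 * logForm w v`. The mixed term comes from
polarising at `√τ w + v / √τ`, whose energy is at most `2 (τ 𝓔(w,w) + 𝓔(v,v) / τ)`. This costs `2C +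
C`, and `logForm w w` costs one more `C`. The free weight `τ` replaces a Cauchy–Schwarz inequality
for the indefinite form. -/
theorem abs_logForm_sub_le (hΩ : Bornology.IsBounded Ω) {C : ℝ} (hC : 0 ≤ C)
    (h : ∀ u ∈ EnergySpace Ω, |logForm u u| ≤ C * energy u u) (hu : u ∈ EnergySpace Ω)
    (hv : v ∈ EnergySpace Ω) {τ : ℝ} (hτ : 1 ≤ τ) :
    |logForm u u - logForm v v| ≤ 4 * C * (τ * energy (u - v) (u - v) + energy v v / τ) := by
  have hw := sub_mem_energySpace hu hv
  set w := u - v with hwdef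
  have hu' : u = (1 : ℝ) • w + (1 : ℝ) • v := by simp [w]
  have hτ0 : 0 < τ := by linarith
  have e1 := logForm_add_smul_self hΩ 1 1 hw hv
  rw [← hu'] at e1
  have e2 := logForm_add_smul_self hΩ (√τ) (√τ)⁻¹ hw hv
  have e3 := energy_add_smul_self (√τ) (√τ)⁻¹ hw hv
  have e4 := energy_add_smul_self (√τ) (-(√τ)⁻¹) hw hv
  have hn := energy_nonneg (√τ • w + (-(√τ)⁻¹) • v)
  have hb := abs_le.1 (h _ (add_smul_mem_energySpace (√τ) (√τ)⁻¹ hw hv))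
  have hsq : √τ ^ 2 = τ := Real.sq_sqrt hτ0.le
  have hinv : √τ * (√τ)⁻¹ = 1 := mul_inv_cancel₀ (Real.sqrt_pos.2 hτ0).ne'
  have hpw : ((√τ)⁻¹) ^ 2 = τ⁻¹ := by rw [inv_pow, hsq]
  rw [e4, hsq, neg_sq, hpw, mul_assoc 2, mul_neg, hinv] at hn
  rw [e2, e3, hsq, hpw, mul_assoc 2, hinv] at hb
  have hbw := abs_le.1 (h w hw)
  have hbv := abs_le.1 (h v hv)
  have hi : 0 < τ⁻¹ := by positivity
  have hew := energy_nonneg w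
  have hev := energy_nonneg v
  have p1 : |τ * logForm w w| ≤ C * (τ * energy w w) := by
    rw [abs_mul, abs_of_pos hτ0]; nlinarith [h w hw]
  have p2 : |τ⁻¹ * logForm v v| ≤ C * (τ⁻¹ * energy v v) := by
    rw [abs_mul, abs_of_pos hi]; nlinarith [h v hv]
  have p1' := abs_le.1 p1
  have p2' := abs_le.1 p2
  have q0 : C * (τ * energy w w + 2 * 1 * energy w v + τ⁻¹ * energy v v) ≤
      C * (2 * (τ * energy w w + τ⁻¹ * energy v v)) :=
    mul_le_mul_of_nonneg_left (by linarith) hC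
  have q1 : C * energy w w ≤ C * (τ * energy w w) :=
    mul_le_mul_of_nonneg_left (le_mul_of_one_le_left hew hτ) hC
  have q2 : 0 ≤ C * (τ⁻¹ * energy v v) := by positivity
  rw [abs_le, div_eq_inv_mul, e1]
  constructor <;> linarith

theorem integrable_sq_max (hu : u ∈ EnergySpace Ω) :
    Integrable (fun x => max (u x) 0 ^ 2) volume := by
  refine (integrable_sq_of_mem_energySpace hu).mono'
    ((hu.1.1.sup aestronglyMeasurable_const).pow 2) (Eventually.of_forall fun x => ?_)
  rw [Real.norm_of_nonneg (sq_nonneg _)]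
  rcases max_cases (u x) 0 with ⟨h, _⟩ | ⟨h, _⟩ <;> rw [h]
  simpa using sq_nonneg (u x)

/-- The positive part is 1-Lipschitz; the product `2 |a - b| |b|` is split by the weighted
arithmetic-geometric inequality, to match the shape of `abs_logForm_sub_le`. -/
theorem abs_sq_max_sub_le (a b : ℝ) {τ : ℝ} (hτ : 1 ≤ τ) :
    |max a 0 ^ 2 - max b 0 ^ 2| ≤ 2 * τ * (a - b) ^ 2 + τ⁻¹ * b ^ 2 := by
  have h1 : |max a 0 - max b 0| ≤ |a - b| := abs_max_sub_max_le_abs a b 0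
  have h2 : |max b 0| ≤ |b| := by
    simpa using abs_max_sub_max_le_abs b 0 0
  have hτ0 : 0 < τ := by linarith
  have h3 : 2 * (|a - b| * |b|) ≤ τ * |a - b| ^ 2 + τ⁻¹ * |b| ^ 2 := by
    have h := mul_nonneg hτ0.le (sq_nonneg (|a - b| - τ⁻¹ * |b|))
    have e : τ * (|a - b| - τ⁻¹ * |b|) ^ 2 =
        τ * |a - b| ^ 2 + τ⁻¹ * |b| ^ 2 - 2 * (|a - b| * |b|) := by
      field_simp; ring
    linarith
  calc |max a 0 ^ 2 - max b 0 ^ 2|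
      = |max a 0 - max b 0| * |(max a 0 - max b 0) + 2 * max b 0| := by
        rw [← abs_mul]; congr 1; ring
    _ ≤ |a - b| * (|a - b| + 2 * |b|) := by
        have := abs_add_le (max a 0 - max b 0) (2 * max b 0)
        rw [abs_mul, abs_two] at this
        gcongr
        linarith
    _ ≤ _ := by
        rw [← sq_abs (a - b), ← sq_abs b]
        nlinarith [sq_nonneg (|a - b|)]

theorem abs_setIntegral_sq_max_sub_le {C : ℝ}
    (h : ∀ u ∈ EnergySpace Ω, ∫ x, u x ^ 2 ≤ C * energy u u) (hu : u ∈ EnergySpace Ω)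
    (hv : v ∈ EnergySpace Ω) {τ : ℝ} (hτ : 1 ≤ τ) :
    |(∫ x in Ω, max (u x) 0 ^ 2) - ∫ x in Ω, max (v x) 0 ^ 2| ≤
      2 * C * (τ * energy (u - v) (u - v) + energy v v / τ) := by
  have hw := sub_mem_energySpace hu hv
  have hτ0 : 0 < τ := by linarith
  have i1 := (integrable_sq_of_mem_energySpace hw).const_mul (2 * τ)
  have i2 := (integrable_sq_of_mem_energySpace hv).const_mul τ⁻¹
  rw [← integral_sub (integrable_sq_max hu).integrableOn (integrable_sq_max hv).integrableOn]
  have h1 : |∫ x in Ω, (max (u x) 0 ^ 2 - max (v x) 0 ^ 2)| ≤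
      ∫ x in Ω, (2 * τ * (u - v) x ^ 2 + τ⁻¹ * v x ^ 2) := by
    rw [← Real.norm_eq_abs]
    exact norm_integral_le_of_norm_le (i1.add i2).integrableOn
      (Eventually.of_forall fun x => abs_sq_max_sub_le _ _ hτ)
  have h2 : ∫ x in Ω, (2 * τ * (u - v) x ^ 2 + τ⁻¹ * v x ^ 2) ≤
      ∫ x, (2 * τ * (u - v) x ^ 2 + τ⁻¹ * v x ^ 2) :=
    setIntegral_le_integral (i1.add i2) (Eventually.of_forall fun x => by
      simp only [Pi.zero_apply]; positivity)
  rw [integral_add i1 i2, integral_const_mul, integral_const_mul] at h2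
  have hi : 0 < τ⁻¹ := by positivity
  have h3 := mul_le_mul_of_nonneg_left (h _ hw) (by positivity : 0 ≤ 2 * τ)
  have h4 := mul_le_mul_of_nonneg_left (h _ hv) hi.le
  have h5 : 0 ≤ τ⁻¹ * ∫ x, v x ^ 2 :=
    mul_nonneg hi.le (integral_nonneg fun x => sq_nonneg _)
  rw [div_eq_inv_mul]
  linarith

theorem continuousOn_of_abs_sub_le {F : (EuclideanSpace ℝ (Fin N) → ℝ) → ℝ} {C : ℝ} (hC : 0 ≤ C)
    (hF : ∀ u ∈ EnergySpace Ω, ∀ v ∈ EnergySpace Ω, ∀ τ : ℝ, 1 ≤ τ →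
      |F u - F v| ≤ C * (τ * energy (u - v) (u - v) + energy v v / τ))
    {γ : ℝ → EuclideanSpace ℝ (Fin N) → ℝ} (hγ : γ ∈ paths Ω φ) :
    ContinuousOn (fun t => F (γ t)) (Icc (-1) 1) := by
  intro t ht
  have hmem := fun s hs => (hγ.1 s hs).1
  have he : Tendsto (fun s => energy (γ s - γ t) (γ s - γ t)) (𝓝[Icc (-1 : ℝ) 1] t) (𝓝 0) := by
    have := (hγ.2.1 t ht).pow 2
    simpa [energyNorm, Real.sq_sqrt (energy_nonneg _)] using this
  rw [ContinuousWithinAt, Metric.tendsto_nhds]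
  intro ε hε
  set A := energy (γ t) (γ t)
  have hA : 0 ≤ A := energy_nonneg _
  -- The weight is fixed before `s → t`: it makes the term `C * A / τ` smaller than `ε / 2`, and the
  -- other term then tends to zero.
  set τ : ℝ := 1 + 2 * C * A / ε
  have hτ : 1 ≤ τ := le_add_of_nonneg_right (by positivity)
  have hτ0 : 0 < τ := by linarith
  have h1 : C * (A / τ) < ε / 2 := by
    rw [← mul_div_assoc, div_lt_iff₀ hτ0]
    have : ε / 2 * τ = ε / 2 + C * A := by simp only [τ]; field_simp
    linarith
  have h2 : ∀ᶠ s in 𝓝[Icc (-1 : ℝ) 1] t, C * (τ * energy (γ s - γ t) (γ s - γ t)) < ε / 2 := by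
    have := (he.const_mul τ).const_mul C
    simp only [mul_zero] at this
    exact this.eventually_lt_const (by positivity)
  filter_upwards [h2, self_mem_nhdsWithin] with s hs hsI
  rw [Real.dist_eq]
  refine (hF _ (hmem s hsI) _ (hmem t ht) τ hτ).trans_lt ?_
  rw [mul_add]
  linarith

theorem continuousOn_logForm_path (hN : 1 ≤ N) (hΩ : Bornology.IsBounded Ω)
    {γ : ℝ → EuclideanSpace ℝ (Fin N) → ℝ} (hγ : γ ∈ paths Ω φ) :
    ContinuousOn (fun t => logForm (γ t) (γ t)) (Icc (-1) 1) := by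
  obtain ⟨C, hC, h⟩ := exists_abs_logForm_le hN hΩ
  exact continuousOn_of_abs_sub_le (F := fun u => logForm u u) (C := 4 * C) (by positivity)
    (fun u hu v hv τ hτ => abs_logForm_sub_le hΩ hC h hu hv hτ) hγ

theorem continuousOn_setIntegral_sq_max_path (hN : 1 ≤ N) (hΩ : Bornology.IsBounded Ω)
    {γ : ℝ → EuclideanSpace ℝ (Fin N) → ℝ} (hγ : γ ∈ paths Ω φ) :
    ContinuousOn (fun t => ∫ x in Ω, max (γ t x) 0 ^ 2) (Icc (-1) 1) := by
  obtain ⟨C, hC, h⟩ := exists_poincare hN hΩ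
  exact continuousOn_of_abs_sub_le (F := fun u => ∫ x in Ω, max (u x) 0 ^ 2) (C := 2 * C)
    (by positivity) (fun u hu v hv τ hτ => abs_setIntegral_sq_max_sub_le h hu hv hτ) hγ

theorem exists_isGreatest_pathValues (hN : 1 ≤ N) (hΩ : Bornology.IsBounded Ω) (r : ℝ)
    {γ : ℝ → EuclideanSpace ℝ (Fin N) → ℝ} (hγ : γ ∈ paths Ω φ) :
    ∃ m, IsGreatest (pathValues Ω r γ) m :=
  (isCompact_Icc.image_of_continuousOn ((continuousOn_logForm_path hN hΩ hγ).sub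
    ((continuousOn_setIntegral_sq_max_path hN hΩ hγ).const_smul r))).exists_isGreatest
    ((nonempty_Icc.2 (by norm_num)).image _)

/-! ### The first eigenvalue as a lower bound -/

theorem bddBelow_logForm (hN : 1 ≤ N) (hΩ : Bornology.IsBounded Ω) :
    BddBelow ((fun u => logForm u u) '' unitSphere Ω) := by
  obtain ⟨K, hK, h⟩ := exists_abs_logForm_sub_energy_le hN hΩ
  refine ⟨-K, ?_⟩
  rintro _ ⟨u, hu, rfl⟩
  have h1 := abs_le.1 (h u hu.1)
  rw [← setIntegral_sq_eq hu.1, hu.2] at h1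
  have := energy_nonneg u
  simp only
  linarith

theorem logForm_eigenfunction_self (hφ : IsFirstEigenfunction Ω φ) :
    logForm φ φ = firstEigenvalue Ω := by
  rw [hφ.2.2 φ hφ.1.1]
  simp only [← sq]
  rw [hφ.1.2, mul_one]

theorem isLeast_firstEigenvalue (hN : 1 ≤ N) (hΩ : Bornology.IsBounded Ω)
    (hφ : IsFirstEigenfunction Ω φ) :
    IsLeast ((fun u => logForm u u) '' unitSphere Ω) (firstEigenvalue Ω) :=
  ⟨⟨φ, hφ.1, logForm_eigenfunction_self hφ⟩,
    fun _ hx => csInf_le (bddBelow_logForm hN hΩ) hx⟩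

theorem logForm_congr_ae (h : u =ᵐ[volume] v) : logForm u u = logForm v v := by
  have h1 := Measure.quasiMeasurePreserving_fst (μ := volume)
    (ν := (volume : Measure (EuclideanSpace ℝ (Fin N)))) |>.ae_eq_comp h
  have h2 := Measure.quasiMeasurePreserving_snd (ν := volume)
    (μ := (volume : Measure (EuclideanSpace ℝ (Fin N)))) |>.ae_eq_comp h
  simp only [logForm, energy]
  congr 1
  · congr 2
    · refine integral_congr_ae ?_
      filter_upwards [h1, h2] with p h1 h2
      simp only [Function.comp_apply] at h1 h2
      rw [h1, h2]
    · refine integral_congr_ae ?_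
      filter_upwards [h1, h2] with p h1 h2
      simp only [Function.comp_apply] at h1 h2
      rw [h1, h2]
  · congr 1
    refine integral_congr_ae ?_
    filter_upwards [h] with x hx
    rw [hx]

/-- The maximum is at least the value at the starting point `-φ`, where the term with `r` is zero
because `φ ≥ 0`. -/
theorem firstEigenvalue_le_of_mem_pathMaxima (hΩ : Bornology.IsBounded Ω)
    (hφ : IsFirstEigenfunction Ω φ) {r m : ℝ} (hm : m ∈ pathMaxima Ω φ r) :
    firstEigenvalue Ω ≤ m := by
  obtain ⟨γ, hγ, hm⟩ := hm
  refine le_of_eq_of_le ?_ (hm.2 ⟨-1, by norm_num, rfl⟩)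
  have h1 : logForm (γ (-1)) (γ (-1)) = firstEigenvalue Ω := by
    rw [logForm_congr_ae hγ.2.2.1, ← logForm_eigenfunction_self hφ]
    simpa using logForm_add_smul_self hΩ (-1) 0 hφ.1.1 hφ.1.1
  have h2 : (∫ x in Ω, max (γ (-1) x) 0 ^ 2) = 0 := by
    refine integral_eq_zero_of_ae (ae_restrict_of_ae ?_)
    filter_upwards [hγ.2.2.1, hφ.2.1] with x hx h0
    rw [hx, Pi.neg_apply, max_eq_right (by linarith)]
    simp
  simp only [functionalE]
  rw [h1, h2]
  ring

/-! ### Points have zero capacity -/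

/-- The cone of height one over the ball of radius `δ` around `c`. -/
noncomputable def tent (c : EuclideanSpace ℝ (Fin N)) (δ : ℝ) (x : EuclideanSpace ℝ (Fin N)) : ℝ :=
  max (1 - ‖x - c‖ / δ) 0

/-- The kernel `|z|^(1/2) k(z)`. -/
noncomputable def sqrtKernel (z : EuclideanSpace ℝ (Fin N)) : ℝ := √‖z‖ * kerK z

/-- In polar coordinates the density is `r^(1/2 - N) r^(N - 1) = r^(-1/2)` on `(0, 1)`. The factor
`|z|^(1/2)` just removes the logarithmic divergence of `k`. -/
theorem integrable_sqrtKernel (hN : 1 ≤ N) : Integrable (sqrtKernel (N := N)) volume := by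
  have : Nonempty (Fin N) := ⟨⟨0, hN⟩⟩
  have : Nontrivial (EuclideanSpace ℝ (Fin N)) := inferInstance
  have h : sqrtKernel (N := N) =
      fun z => (fun r : ℝ => √r * (Iio (1 : ℝ)).indicator (fun r => 1 / r ^ N) r) ‖z‖ := by
    ext z
    simp [sqrtKernel, kerK, indicator]
  rw [h, integrable_fun_norm_addHaar volume
    (f := fun r : ℝ => √r * (Iio (1 : ℝ)).indicator (fun r => 1 / r ^ N) r)]
  have h1 : IntegrableOn (fun r : ℝ => r ^ (-(1 / 2) : ℝ)) (Ioo 0 1) :=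
    (intervalIntegral.integrableOn_Ioo_rpow_iff one_pos).2 (by norm_num)
  have h2 := (integrable_indicator_iff measurableSet_Ioo).2 h1
  refine (h2.integrableOn (s := Ioi 0)).congr_fun (fun r hr => ?_) measurableSet_Ioi
  have hr : 0 < r := hr
  by_cases hr1 : r < 1
  · have hN' : r ^ N = r ^ (N - 1) * r := by rw [← pow_succ, Nat.sub_add_cancel hN]
    simp only [mem_Ioo, hr, hr1, and_self, indicator_of_mem, mem_Iio, finrank_euclideanSpace,
      Fintype.card_fin, smul_eq_mul, hN']
    rw [Real.rpow_neg hr.le, ← Real.sqrt_eq_rpow]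
    have hs := Real.sqrt_pos.2 hr
    field_simp
    rw [Real.sq_sqrt hr.le]
  · simp [hr1]

theorem sqrtKernel_nonneg (z : EuclideanSpace ℝ (Fin N)) : 0 ≤ sqrtKernel z :=
  mul_nonneg (Real.sqrt_nonneg _) (kerK_nonneg z)

theorem sqrtKernel_neg (z : EuclideanSpace ℝ (Fin N)) : sqrtKernel (-z) = sqrtKernel z := by
  simp [sqrtKernel, kerK, indicator]

variable {c : EuclideanSpace ℝ (Fin N)} {δ : ℝ}

theorem tent_nonneg (x : EuclideanSpace ℝ (Fin N)) : 0 ≤ tent c δ x := le_max_right _ _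

theorem tent_le_one (hδ : 0 < δ) (x : EuclideanSpace ℝ (Fin N)) : tent c δ x ≤ 1 :=
  max_le (by have : 0 ≤ ‖x - c‖ / δ := by positivity
             linarith) zero_le_one

theorem tent_eq_zero (hδ : 0 < δ) {x : EuclideanSpace ℝ (Fin N)} (hx : x ∉ Metric.ball c δ) :
    tent c δ x = 0 := by
  rw [Metric.mem_ball, dist_eq_norm, not_lt] at hx
  exact max_eq_right (by linarith [(one_le_div hδ).2 hx])

theorem half_le_tent (hδ : 0 < δ) {x : EuclideanSpace ℝ (Fin N)}
    (hx : x ∈ Metric.ball c (δ / 2)) : 1 / 2 ≤ tent c δ x := by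
  rw [Metric.mem_ball, dist_eq_norm] at hx
  have : ‖x - c‖ / δ ≤ 1 / 2 := by rw [div_le_iff₀ hδ]; linarith
  exact le_max_of_le_left (by linarith)

theorem continuous_tent : Continuous (tent c δ) := by
  unfold tent; fun_prop

/-- The difference `d` is at most both `1` and `‖x - y‖ / δ`, so `d⁴ ≤ d ≤ ‖x - y‖ / δ`. This weak
Hölder bound suffices to turn `k` into the integrable `sqrtKernel` at a cost of only `δ^(-1/2)`. -/
theorem sq_tent_sub_le (hδ : 0 < δ) (x y : EuclideanSpace ℝ (Fin N)) :
    (tent c δ x - tent c δ y) ^ 2 ≤ √(‖x - y‖ / δ) := by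
  have h0 : 0 ≤ ‖x - y‖ / δ := by positivity
  have h1 : |tent c δ x - tent c δ y| ≤ ‖x - y‖ / δ := by
    refine (abs_max_sub_max_le_abs _ _ _).trans ?_
    have : 1 - ‖x - c‖ / δ - (1 - ‖y - c‖ / δ) = (‖y - c‖ - ‖x - c‖) / δ := by ring
    rw [this, abs_div, abs_of_pos hδ]
    gcongr
    refine (abs_norm_sub_norm_le _ _).trans_eq ?_
    rw [sub_sub_sub_cancel_right, norm_sub_rev]
  have h2 : |tent c δ x - tent c δ y| ≤ 1 := by
    rw [abs_le]
    constructor <;> linarith [tent_nonneg (c := c) (δ := δ) x, tent_nonneg (c := c) (δ := δ) y,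
      tent_le_one (c := c) hδ x, tent_le_one (c := c) hδ y]
  rw [← sq_abs]
  set d := |tent c δ x - tent c δ y|
  have hd : 0 ≤ d := abs_nonneg _
  refine Real.le_sqrt_of_sq_le (le_trans ?_ h1)
  calc (d ^ 2) ^ 2 = d * d ^ 3 := by ring
    _ ≤ d * 1 := by gcongr; exact pow_le_one₀ hd h2
    _ = d := mul_one d

theorem integrable_indicator_mul_sqrtKernel (hN : 1 ≤ N) (c : EuclideanSpace ℝ (Fin N)) (δ : ℝ) :
    Integrable (fun p : EuclideanSpace ℝ (Fin N) × EuclideanSpace ℝ (Fin N) =>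
      (Metric.ball c δ).indicator 1 p.2 * sqrtKernel (p.1 - p.2)) (volume.prod volume) ∧
    ∫ p : EuclideanSpace ℝ (Fin N) × EuclideanSpace ℝ (Fin N),
      (Metric.ball c δ).indicator 1 p.2 * sqrtKernel (p.1 - p.2) ∂(volume.prod volume) =
      (volume (Metric.ball c δ)).toReal * ∫ z, sqrtKernel (N := N) z := by
  have hB : Integrable ((Metric.ball c δ).indicator (1 : EuclideanSpace ℝ (Fin N) → ℝ)) volume :=
    (integrable_indicator_iff Metric.isOpen_ball.measurableSet).2
      (integrableOn_const measure_ball_lt_top.ne)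
  have hint : Integrable (fun p : EuclideanSpace ℝ (Fin N) × EuclideanSpace ℝ (Fin N) =>
      (Metric.ball c δ).indicator 1 p.2 * sqrtKernel (p.1 - p.2)) (volume.prod volume) :=
    hB.convolution_integrand (ContinuousLinearMap.mul ℝ ℝ) (integrable_sqrtKernel hN)
  refine ⟨hint, ?_⟩
  rw [integral_prod_symm _ hint]
  simp only [integral_const_mul, integral_sub_right_eq_self (sqrtKernel (N := N))]
  rw [integral_mul_const, integral_indicator_one Metric.isOpen_ball.measurableSet, Measure.real]

/-- The left side vanishes unless one of the two points lies in the ball; the two indicators keep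
this localisation, which yields the factor `|B_δ|` after integration. -/
theorem tent_energy_integrand_le (hδ : 0 < δ)
    (p : EuclideanSpace ℝ (Fin N) × EuclideanSpace ℝ (Fin N)) :
    (tent c δ p.1 - tent c δ p.2) ^ 2 * kerK (p.1 - p.2) ≤
      (√δ)⁻¹ * ((Metric.ball c δ).indicator 1 p.2 * sqrtKernel (p.1 - p.2) +
        (Metric.ball c δ).indicator 1 p.1 * sqrtKernel (p.1 - p.2)) := by
  have hs := sqrtKernel_nonneg (p.1 - p.2)
  have hi : 0 ≤ (√δ)⁻¹ := by positivity
  have h1 : ∀ x, (0 : ℝ) ≤ (Metric.ball c δ).indicator 1 x :=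
    fun x => indicator_nonneg (fun _ _ => zero_le_one) x
  have hmain : (tent c δ p.1 - tent c δ p.2) ^ 2 * kerK (p.1 - p.2) ≤
      (√δ)⁻¹ * sqrtKernel (p.1 - p.2) := by
    refine (mul_le_mul_of_nonneg_right (sq_tent_sub_le hδ _ _) (kerK_nonneg _)).trans_eq ?_
    rw [Real.sqrt_div (norm_nonneg _), sqrtKernel]
    ring
  by_cases hp1 : p.1 ∈ Metric.ball c δ
  · refine hmain.trans (mul_le_mul_of_nonneg_left ?_ hi)
    rw [indicator_of_mem hp1, Pi.one_apply, one_mul]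
    exact le_add_of_nonneg_left (mul_nonneg (h1 _) hs)
  by_cases hp2 : p.2 ∈ Metric.ball c δ
  · refine hmain.trans (mul_le_mul_of_nonneg_left ?_ hi)
    rw [indicator_of_mem hp2, Pi.one_apply, one_mul]
    exact le_add_of_nonneg_right (mul_nonneg (h1 _) hs)
  rw [tent_eq_zero hδ hp1, tent_eq_zero hδ hp2]
  have := h1 p.1
  have := h1 p.2
  simp only [sub_self]
  rw [zero_pow two_ne_zero, zero_mul]
  positivity

theorem tent_mem_energySpace (hN : 1 ≤ N) (hδ : 0 < δ) (hsub : Metric.ball c δ ⊆ Ω) :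
    tent c δ ∈ EnergySpace Ω ∧
      energy (tent c δ) (tent c δ) ≤ cConst N * ((√δ)⁻¹ *
        ((volume (Metric.ball c δ)).toReal * ∫ z, sqrtKernel (N := N) z)) := by
  obtain ⟨i1, e1⟩ := integrable_indicator_mul_sqrtKernel hN c δ
  have hsw : ∀ p : EuclideanSpace ℝ (Fin N) × EuclideanSpace ℝ (Fin N),
      (Metric.ball c δ).indicator 1 p.swap.2 * sqrtKernel (p.swap.1 - p.swap.2) =
      ((Metric.ball c δ).indicator 1 p.1 * sqrtKernel (p.1 - p.2) : ℝ) := fun p => by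
    rw [Prod.fst_swap, Prod.snd_swap, ← sqrtKernel_neg, neg_sub]
  have i2 : Integrable (fun p : EuclideanSpace ℝ (Fin N) × EuclideanSpace ℝ (Fin N) =>
      (Metric.ball c δ).indicator 1 p.1 * sqrtKernel (p.1 - p.2)) (volume.prod volume) :=
    i1.swap.congr (Eventually.of_forall hsw)
  have e2 := integral_prod_swap (μ := (volume : Measure (EuclideanSpace ℝ (Fin N))))
    (ν := (volume : Measure (EuclideanSpace ℝ (Fin N))))
    (fun p : EuclideanSpace ℝ (Fin N) × EuclideanSpace ℝ (Fin N) =>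
      ((Metric.ball c δ).indicator 1 p.2 * sqrtKernel (p.1 - p.2) : ℝ))
  simp only [hsw] at e2
  rw [e1] at e2
  have i3 := (i1.add i2).const_mul (√δ)⁻¹
  have hL : MemLp (tent c δ) 2 volume := by
    refine continuous_tent.memLp_of_hasCompactSupport
      (HasCompactSupport.intro (isCompact_closedBall c δ) fun x hx => ?_)
    exact tent_eq_zero hδ fun h => hx (Metric.ball_subset_closedBall h)
  have hmem : tent c δ ∈ EnergySpace Ω := by
    refine ⟨hL, Eventually.of_forall fun x hx => tent_eq_zero hδ fun h => hx (hsub h), ?_⟩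
    refine i3.mono' (((aestronglyMeasurable_sub_prod hL.1).norm.pow 2).mul
      aestronglyMeasurable_kerK_sub) (Eventually.of_forall fun p => ?_)
    rw [sq_abs, Real.norm_of_nonneg (mul_nonneg (sq_nonneg _) (kerK_nonneg _))]
    exact tent_energy_integrand_le hδ p
  refine ⟨hmem, ?_⟩
  have h1 := integral_mono (integrable_energy hmem hmem) i3
    (fun p => (congrArg (· * kerK (p.1 - p.2)) (sq _).symm).trans_le
      (tent_energy_integrand_le hδ p))
  rw [integral_const_mul] at h1
  simp only [Pi.add_apply] at h1
  rw [integral_add i1 i2, e1, e2] at h1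
  rw [energy]
  have hc := cConst_pos hN
  calc _ ≤ _ := mul_le_mul_of_nonneg_left h1 (by positivity)
    _ = _ := by ring

/-- The energy is at most a constant times `δ^(-1/2) δ^N`, hence times `√δ` for `δ < 1`; this works
in every dimension `N ≥ 1`. -/
theorem tendsto_energy_tent (hN : 1 ≤ N) (hΩ : IsOpen Ω) (hc : c ∈ Ω) :
    (∀ᶠ δ in 𝓝[>] (0 : ℝ), tent c δ ∈ EnergySpace Ω) ∧
    Tendsto (fun δ => energy (tent c δ) (tent c δ)) (𝓝[>] 0) (𝓝 0) := by
  have : Nonempty (Fin N) := ⟨⟨0, hN⟩⟩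
  have : Nontrivial (EuclideanSpace ℝ (Fin N)) := inferInstance
  obtain ⟨ε, hε, hsub⟩ := Metric.isOpen_iff.1 hΩ c hc
  have hev : ∀ᶠ δ in 𝓝[>] (0 : ℝ), 0 < δ ∧ δ < ε ∧ δ < 1 := by
    filter_upwards [self_mem_nhdsWithin, mem_nhdsWithin_of_mem_nhds (Iio_mem_nhds hε),
      mem_nhdsWithin_of_mem_nhds (Iio_mem_nhds one_pos)] with δ h1 h2 h3 using ⟨h1, h2, h3⟩
  refine ⟨hev.mono fun δ h => (tent_mem_energySpace hN h.1
    ((Metric.ball_subset_ball h.2.1.le).trans hsub)).1, ?_⟩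
  set V := (volume (Metric.ball (0 : EuclideanSpace ℝ (Fin N)) 1)).toReal
  set K := ∫ z, sqrtKernel (N := N) z
  have hK : 0 ≤ K := integral_nonneg sqrtKernel_nonneg
  have hlim : Tendsto (fun δ : ℝ => cConst N * (√δ * (V * K))) (𝓝[>] 0) (𝓝 0) := by
    have h : Continuous fun δ : ℝ => cConst N * (√δ * (V * K)) := by fun_prop
    simpa using (h.tendsto 0).mono_left nhdsWithin_le_nhds
  refine squeeze_zero' (Eventually.of_forall fun δ => energy_nonneg _) ?_ hlim
  filter_upwards [hev] with δ ⟨h0, h1, h2⟩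
  refine (tent_mem_energySpace hN h0
    ((Metric.ball_subset_ball h1.le).trans hsub)).2.trans ?_
  have hcN := cConst_pos hN
  have hvol : (volume (Metric.ball c δ)).toReal = δ ^ N * V := by
    rw [Measure.addHaar_ball _ _ h0.le, ENNReal.toReal_mul, ENNReal.toReal_ofReal (by positivity),
      finrank_euclideanSpace, Fintype.card_fin]
  have hpow : δ ^ N ≤ δ := pow_le_of_le_one h0.le h2.le (by omega)
  have hsq : (√δ)⁻¹ * δ = √δ := by
    rw [inv_mul_eq_div, Real.div_sqrt]
  rw [hvol]
  calc _ ≤ cConst N * ((√δ)⁻¹ * (δ * V * K)) := by gcongr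
    _ = cConst N * ((√δ)⁻¹ * δ * (V * K)) := by ring
    _ = _ := by rw [hsq]

/-- Points have capacity zero: in every open set there are functions of arbitrarily small energy
which are not dominated by a given finite function. -/
theorem exists_small_not_le (hN : 1 ≤ N) (hΩ : IsOpen Ω) (hne : Ω.Nonempty)
    (φ : EuclideanSpace ℝ (Fin N) → ℝ) {κ : ℝ} (hκ : 0 < κ) :
    ∃ ψ ∈ EnergySpace Ω, (∀ x, 0 ≤ ψ x) ∧ energy ψ ψ < κ ∧ ¬ (ψ ≤ᵐ[volume] φ) := by
  obtain ⟨M, hM0, hM⟩ : ∃ M : ℝ, 0 < M ∧ volume {x ∈ Ω | φ x < M} ≠ 0 := by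
    by_contra! h
    have h1 : Ω ⊆ ⋃ n : ℕ, {x ∈ Ω | φ x < n + 1} := fun x hx => by
      obtain ⟨n, hn⟩ := exists_nat_gt (φ x)
      exact mem_iUnion.2 ⟨n, hx, by linarith⟩
    refine (hΩ.measure_pos volume hne).ne' (measure_mono_null h1 ?_)
    exact measure_iUnion_null fun n => h _ (by positivity)
  -- Tents are centred at a point near which `{φ < M}` has positive measure at every scale, so that
  -- shrinking `δ` cannot lose this set.
  obtain ⟨c, hc, hpos⟩ := exists_mem_forall_mem_nhdsWithin_pos_measure hM
  obtain ⟨h1, h2⟩ := tendsto_energy_tent hN hΩ hc.1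
  have h3 := (h2.const_mul ((2 * M) ^ 2))
  rw [mul_zero] at h3
  obtain ⟨δ, ⟨hδ, hmem⟩, hlt⟩ := ((self_mem_nhdsWithin (s := Ioi (0 : ℝ)) |> fun h =>
    (Filter.Eventually.and h h1)).and (h3.eventually_lt_const hκ)).exists
  have hδ : 0 < δ := hδ
  -- On the half ball the tent is at least `1/2`, so this multiple is at least `M` there and exceeds
  -- `φ` on `{φ < M}`.
  refine ⟨(2 * M) • tent c δ, smul_mem_energySpace _ hmem, fun x => ?_, ?_, fun hle => ?_⟩
  · exact mul_nonneg (by positivity) (tent_nonneg x)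
  · simpa using (energy_add_smul_self (2 * M) 0 hmem hmem).trans_lt (by simpa using hlt)
  · have hU : {x ∈ Ω | φ x < M} ∩ Metric.ball c (δ / 2) ∈ 𝓝[{x ∈ Ω | φ x < M}] c :=
      inter_mem self_mem_nhdsWithin
        (mem_nhdsWithin_of_mem_nhds (Metric.ball_mem_nhds c (by positivity)))
    refine (hpos _ hU).ne' (measure_mono_null (fun x hx => ?_) (ae_iff.1 hle))
    have := half_le_tent hδ hx.2
    simp only [Pi.smul_apply, smul_eq_mul, mem_ofPred_eq, not_le]
    nlinarith [hx.1.2]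

theorem setIntegral_sq_max_pos (hu : u ∈ EnergySpace Ω) (h : ¬ u ≤ᵐ[volume] 0) :
    0 < ∫ x in Ω, max (u x) 0 ^ 2 := by
  have h0 : 0 ≤ ∫ x, max (u x) 0 ^ 2 := integral_nonneg fun x => sq_nonneg _
  have he : ∫ x in Ω, max (u x) 0 ^ 2 = ∫ x, max (u x) 0 ^ 2 :=
    setIntegral_eq_integral_of_ae_compl_eq_zero (by
      filter_upwards [hu.2.1] with x hx h
      simp [hx h])
  rw [he]
  refine h0.lt_of_ne fun hz => h ?_
  have h2 := (integral_eq_zero_iff_of_nonneg (fun x => sq_nonneg _) (integrable_sq_max hu)).1 hz.symm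
  filter_upwards [h2] with x hx
  simpa using hx

theorem setIntegral_sq_max_le (hu : u ∈ EnergySpace Ω) :
    ∫ x in Ω, max (u x) 0 ^ 2 ≤ ∫ x, u x ^ 2 := by
  refine (setIntegral_le_integral (integrable_sq_max hu)
    (Eventually.of_forall fun x => sq_nonneg _)).trans
    (integral_mono (integrable_sq_max hu) (integrable_sq_of_mem_energySpace hu) fun x => ?_)
  rcases max_cases (u x) 0 with ⟨h, _⟩ | ⟨h, _⟩ <;> simp only [h]
  · exact le_rfl
  · simpa using sq_nonneg (u x)

/-! ### The path through `ψ - φ` -/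

/-- A continuous normalised curve of linear combinations of `φ` and `ψ` is a path. -/
theorem add_smul_mem_paths (hφ : φ ∈ EnergySpace Ω) (hψ : ψ ∈ EnergySpace Ω) {α β : ℝ → ℝ}
    (hα : ContinuousOn α (Icc (-1) 1)) (hβ : ContinuousOn β (Icc (-1) 1))
    (hnorm : ∀ t ∈ Icc (-1 : ℝ) 1, ∫ x, (α t • φ + β t • ψ) x ^ 2 = 1)
    (hα0 : α (-1) = -1) (hβ0 : β (-1) = 0) (hα1 : α 1 = 1) (hβ1 : β 1 = 0) :
    (fun t => α t • φ + β t • ψ) ∈ paths Ω φ := by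
  refine ⟨fun t ht => ?_, fun t ht => ?_, ?_, ?_⟩
  · have := add_smul_mem_energySpace (α t) (β t) hφ hψ
    exact ⟨this, (setIntegral_sq_eq this).trans (hnorm t ht)⟩
  · have h : ∀ s, energyNorm ((α s • φ + β s • ψ) - (α t • φ + β t • ψ)) =
        √((α s - α t) ^ 2 * energy φ φ + 2 * (α s - α t) * (β s - β t) * energy φ ψ +
          (β s - β t) ^ 2 * energy ψ ψ) := fun s => by
      rw [energyNorm, ← energy_add_smul_self _ _ hφ hψ]
      congr 2 <;> module
    simp only [h]
    have hα' := (hα t ht).sub_const (α t)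
    have hβ' := (hβ t ht).sub_const (β t)
    have := ((((hα'.pow 2).mul_const (energy φ φ)).add (((hα'.const_mul 2).mul hβ').mul_const
      (energy φ ψ))).add ((hβ'.pow 2).mul_const (energy ψ ψ))).sqrt
    simpa using this
  · simp [hα0, hβ0]
  · simp [hα1, hβ1]

/-- The polygon `-φ`, `ψ - φ`, `φ` is normalised in `L²`. Its first side is cheap because `ψ` has
small energy; on its second side the positive part survives because `ψ ≤ φ` fails. -/
theorem exists_path (hN : 1 ≤ N) (hΩo : IsOpen Ω) (hne : Ω.Nonempty)
    (hΩ : Bornology.IsBounded Ω) (hφ : IsFirstEigenfunction Ω φ) {ε : ℝ} (hε : 0 < ε) :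
    ∃ γ ∈ paths Ω φ,
      (∀ t ∈ Icc (-1 : ℝ) 0, logForm (γ t) (γ t) ≤ firstEigenvalue Ω + ε) ∧
      ∀ t ∈ Icc (0 : ℝ) 1, 0 < ∫ x in Ω, max (γ t x) 0 ^ 2 := by
  obtain ⟨C, hC, hCL⟩ := exists_abs_logForm_le hN hΩ
  obtain ⟨C', hC', hCP⟩ := exists_poincare hN hΩ
  set l := firstEigenvalue Ω with hl
  -- The first bound yields `∫ ψ² ≤ 1/4`, which keeps the normalising factor under control; the
  -- second yields `4 (q - l s) ≤ ε`.
  have hκ : 0 < min (1 / (4 * (C' + 1))) (ε / (4 * (C + |l| * C' + 1))) := by positivity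
  obtain ⟨ψ, hψ, hψ0, hψe, hψφ⟩ := exists_small_not_le hN hΩo hne φ hκ
  have hφm := hφ.1.1
  have hE := energy_nonneg ψ
  obtain ⟨hψe1, hψe2⟩ := lt_min_iff.1 hψe
  rw [lt_div_iff₀ (by positivity)] at hψe1 hψe2
  have hφ1 : ∫ x, φ x ^ 2 = 1 := (setIntegral_sq_eq hφm).symm.trans hφ.1.2
  set m := ∫ x, φ x * ψ x with hm
  set s := ∫ x, ψ x ^ 2 with hs
  set q := logForm ψ ψ with hq
  have hs0 : 0 ≤ s := integral_nonneg fun x => sq_nonneg _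
  have hsP : s ≤ C' * energy ψ ψ := hCP ψ hψ
  have hs1 : s ≤ 1 / 4 := by linarith
  have hqs : 4 * (q - l * s) ≤ ε := by
    have h1 := (abs_le.1 (hCL ψ hψ)).2
    have h2 : -(l * s) ≤ |l| * (C' * energy ψ ψ) := by
      calc -(l * s) ≤ |l| * s := by nlinarith [neg_abs_le l]
        _ ≤ _ := by gcongr
    linarith
  set a : ℝ → ℝ := fun t => max (-1) (2 * t - 1) with ha
  set b : ℝ → ℝ := fun t => 1 - |t| with hb
  set g : ℝ → ℝ := fun t => ∫ x, (a t • φ + b t • ψ) x ^ 2 with hg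
  have hV : ∀ t, a t • φ + b t • ψ ∈ EnergySpace Ω := fun t =>
    add_smul_mem_energySpace _ _ hφm hψ
  have hgeq : ∀ t, g t = a t ^ 2 + 2 * a t * b t * m + b t ^ 2 * s := fun t => by
    simp only [g]
    rw [integral_sq_add_smul _ _ hφm hψ, hφ1, mul_one]
  have ha_neg : ∀ t ∈ Icc (-1 : ℝ) 0, a t = -1 := fun t ht => max_eq_left (by linarith [ht.2])
  have hb_mem : ∀ t ∈ Icc (-1 : ℝ) 1, 0 ≤ b t ∧ b t ≤ 1 := fun t ht => by
    have := abs_le.2 ht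
    simp only [b]
    constructor <;> linarith [abs_nonneg t]
  have hg_neg : ∀ t ∈ Icc (-1 : ℝ) 0, 1 / 4 ≤ g t := fun t ht => by
    obtain ⟨hb0, hb1⟩ := hb_mem t ⟨ht.1, ht.2.trans zero_le_one⟩
    -- Expanding this square gives `2 b m ≤ 1/2 + 2 b² s`, hence `g ≥ 1/2 - b² s ≥ 1/4`.
    have h1 : 0 ≤ ∫ x, ((1 : ℝ) • φ + (-2 * b t) • ψ) x ^ 2 :=
      integral_nonneg fun x => sq_nonneg _
    rw [integral_sq_add_smul _ _ hφm hψ, hφ1] at h1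
    rw [hgeq, ha_neg t ht]
    have h2 : b t ^ 2 * s ≤ s := mul_le_of_le_one_left hs0 (pow_le_one₀ hb0 hb1)
    linarith
  have hv_pos : ∀ t ∈ Icc (0 : ℝ) 1, ¬ (a t • φ + b t • ψ ≤ᵐ[volume] 0) := fun t ht hle => by
    have ha' : a t = 2 * t - 1 := max_eq_right (by linarith [ht.1])
    have hb' : b t = 1 - t := by simp only [b, abs_of_nonneg ht.1]
    rcases ht.2.eq_or_lt with h1 | h1
    · rw [ha', hb', h1] at hle
      have : ∫ x, φ x ^ 2 = 0 := integral_eq_zero_of_ae (by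
        filter_upwards [hle, hφ.2.1] with x h1 h2
        norm_num at h1
        simp [le_antisymm h1 h2])
      linarith
    · refine hψφ ?_
      filter_upwards [hle, hφ.2.1] with x hx h2
      simp only [Pi.add_apply, Pi.smul_apply, smul_eq_mul, Pi.zero_apply, ha', hb'] at hx
      -- The combination equals `(1 - t) (ψ - φ) + t φ`, and `t φ ≥ 0`.
      have : (1 - t) * (ψ x - φ x) ≤ 0 := by nlinarith [ht.1]
      nlinarith
  have hg_pos : ∀ t ∈ Icc (-1 : ℝ) 1, 0 < g t := fun t ht => by
    rcases le_total t 0 with h | h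
    · linarith [hg_neg t ⟨ht.1, h⟩]
    · exact (setIntegral_sq_max_pos (hV t) (hv_pos t ⟨h, ht.2⟩)).trans_le
        (setIntegral_sq_max_le (hV t))
  have hac : Continuous a := by fun_prop
  have hbc : Continuous b := by fun_prop
  have hgc : Continuous g := by
    rw [show g = fun t => a t ^ 2 + 2 * a t * b t * m + b t ^ 2 * s from funext hgeq]
    fun_prop
  set k : ℝ → ℝ := fun t => (√(g t))⁻¹ with hk
  have hkc : ContinuousOn k (Icc (-1) 1) :=
    hgc.sqrt.continuousOn.inv₀ fun t ht => (Real.sqrt_pos.2 (hg_pos t ht)).ne'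
  have hk2 : ∀ t ∈ Icc (-1 : ℝ) 1, k t ^ 2 = (g t)⁻¹ := fun t ht => by
    rw [hk, inv_pow, Real.sq_sqrt (hg_pos t ht).le]
  have hγ : ∀ t, (k t * a t) • φ + (k t * b t) • ψ = k t • (a t • φ + b t • ψ) := fun t => by
    rw [smul_add, smul_smul, smul_smul]
  have hgm1 : g (-1) = 1 := by rw [hgeq]; norm_num [a, b]
  have hg1 : g 1 = 1 := by rw [hgeq]; norm_num [a, b]
  refine ⟨fun t => (k t * a t) • φ + (k t * b t) • ψ,
    add_smul_mem_paths hφm hψ (hkc.mul hac.continuousOn) (hkc.mul hbc.continuousOn)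
      (fun t ht => ?_) ?_ ?_ ?_ ?_, fun t ht => ?_, fun t ht => ?_⟩
  · rw [hγ]
    simp only [Pi.smul_apply (k t), smul_eq_mul, mul_pow]
    rw [integral_const_mul, hk2 t ht]
    exact inv_mul_cancel₀ (hg_pos t ht).ne'
  · norm_num [k, hgm1, a]
  · norm_num [b]
  · norm_num [k, hg1, a]
  · norm_num [b]
  · have ht' : t ∈ Icc (-1 : ℝ) 1 := ⟨ht.1, ht.2.trans zero_le_one⟩
    have hlm : logForm φ ψ = l * m := by
      rw [hφ.2.2 ψ hψ, setIntegral_mul_eq _ hφm]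
    -- Since `logForm φ ψ = l m`, the terms in `a²` and `a b` are exactly those of `l * g t`; only
    -- the `b²` term is left as an error.
    have hlf : logForm (a t • φ + b t • ψ) (a t • φ + b t • ψ) =
        l * g t + b t ^ 2 * (q - l * s) := by
      rw [logForm_add_smul_self hΩ _ _ hφm hψ, logForm_eigenfunction_self hφ, hlm, hgeq]
      ring
    have hsm := logForm_add_smul_self hΩ (k t) 0 (hV t) (hV t)
    simp only [zero_smul, add_zero, mul_zero, zero_mul, ne_eq, OfNat.ofNat_ne_zero,
      not_false_eq_true, zero_pow] at hsm
    simp only [hγ]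
    rw [hsm, hlf, hk2 t ht', inv_mul_le_iff₀ (hg_pos t ht'), mul_add, mul_comm l]
    obtain ⟨hb0, hb1⟩ := hb_mem t ht'
    have h1 : b t ^ 2 ≤ 1 := pow_le_one₀ hb0 hb1
    have h2 := hg_neg t ht
    -- Together with `g ≥ 1/4`, the error is at most `ε * g t`, so it is at most `ε` after
    -- normalisation.
    have h3 : b t ^ 2 * (q - l * s) ≤ ε / 4 := by nlinarith [sq_nonneg (b t)]
    nlinarith
  · have ht' : t ∈ Icc (-1 : ℝ) 1 := ⟨by linarith [ht.1], ht.2⟩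
    have hkpos : 0 < k t := inv_pos.2 (Real.sqrt_pos.2 (hg_pos t ht'))
    simp only [hγ]
    refine setIntegral_sq_max_pos (smul_mem_energySpace _ (hV t)) fun hle => hv_pos t ht ?_
    filter_upwards [hle] with x hx
    exact nonpos_of_mul_nonpos_right hx hkpos

/-! ### The limit of the minimax levels -/

theorem exists_mem_pathMaxima_le (hN : 1 ≤ N) (hΩo : IsOpen Ω) (hne : Ω.Nonempty)
    (hΩ : Bornology.IsBounded Ω) (hφ : IsFirstEigenfunction Ω φ) {ε : ℝ} (hε : 0 < ε) :
    ∃ R : ℝ, ∀ r, R ≤ r → ∃ m ∈ pathMaxima Ω φ r, m ≤ firstEigenvalue Ω + ε := by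
  obtain ⟨γ, hγ, hneg, hpos⟩ := exists_path hN hΩo hne hΩ hφ hε
  have hL := continuousOn_logForm_path hN hΩ hγ
  have hP := continuousOn_setIntegral_sq_max_path hN hΩ hγ
  have hsub : Icc (0 : ℝ) 1 ⊆ Icc (-1) 1 := Icc_subset_Icc_left (by norm_num)
  obtain ⟨t₀, ht₀, hmin⟩ := isCompact_Icc.exists_isMinOn (nonempty_Icc.2 zero_le_one) (hP.mono hsub)
  obtain ⟨B, hB⟩ := (isCompact_Icc.image_of_continuousOn hL).bddAbove
  set d := ∫ x in Ω, max (γ t₀ x) 0 ^ 2 with hd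
  have hd0 : 0 < d := hpos t₀ ht₀
  -- On `[0, 1]` the form is at most `B` and the positive part contributes at least `d`, so `B - r d
  -- ≤ λ₁ + ε` is what is needed. On `[-1, 0]` it is enough that `r ≥ 0`.
  refine ⟨max 0 ((B - firstEigenvalue Ω - ε) / d), fun r hr => ?_⟩
  obtain ⟨hr0, hr1⟩ := max_le_iff.1 hr
  rw [div_le_iff₀ hd0] at hr1
  obtain ⟨m, hm⟩ := exists_isGreatest_pathValues hN hΩ r hγ
  refine ⟨m, ⟨γ, hγ, hm⟩, ?_⟩
  obtain ⟨t, ht, rfl⟩ := hm.1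
  simp only [functionalE]
  rcases le_total t 0 with h | h
  · have h1 := hneg t ⟨ht.1, h⟩
    have h2 : 0 ≤ ∫ x in Ω, max (γ t x) 0 ^ 2 := integral_nonneg fun x => sq_nonneg _
    nlinarith [mul_nonneg hr0 h2]
  · have h1 : logForm (γ t) (γ t) ≤ B := hB ⟨t, ht, rfl⟩
    have h2 : d ≤ ∫ x in Ω, max (γ t x) 0 ^ 2 := hmin ⟨h, ht.2⟩
    nlinarith [mul_le_mul_of_nonneg_left h2 hr0]

theorem pathMaxima_nonempty (hN : 1 ≤ N) (hΩo : IsOpen Ω) (hne : Ω.Nonempty)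
    (hΩ : Bornology.IsBounded Ω) (hφ : IsFirstEigenfunction Ω φ) (r : ℝ) :
    (pathMaxima Ω φ r).Nonempty := by
  obtain ⟨γ, hγ, -⟩ := exists_path hN hΩo hne hΩ hφ one_pos
  obtain ⟨m, hm⟩ := exists_isGreatest_pathValues hN hΩ r hγ
  exact ⟨m, γ, hγ, hm⟩

theorem isGLB_minimaxLevel (hN : 1 ≤ N) (hΩo : IsOpen Ω) (hne : Ω.Nonempty)
    (hΩ : Bornology.IsBounded Ω) (hφ : IsFirstEigenfunction Ω φ) (r : ℝ) :
    IsGLB (pathMaxima Ω φ r) (minimaxLevel Ω φ r) :=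
  isGLB_csInf (pathMaxima_nonempty hN hΩo hne hΩ hφ r)
    ⟨firstEigenvalue Ω, fun _ hm => firstEigenvalue_le_of_mem_pathMaxima hΩ hφ hm⟩

theorem tendsto_minimaxLevel (hN : 1 ≤ N) (hΩo : IsOpen Ω) (hne : Ω.Nonempty)
    (hΩ : Bornology.IsBounded Ω) (hφ : IsFirstEigenfunction Ω φ) :
    Tendsto (fun r => minimaxLevel Ω φ r) atTop (𝓝 (firstEigenvalue Ω)) := by
  refine Metric.tendsto_atTop.2 fun ε hε => ?_
  obtain ⟨R, hR⟩ := exists_mem_pathMaxima_le hN hΩo hne hΩ hφ (half_pos hε)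
  refine ⟨R, fun r hr => ?_⟩
  have hglb := isGLB_minimaxLevel hN hΩo hne hΩ hφ r
  obtain ⟨m, hm, hle⟩ := hR r hr
  have h1 := hglb.1 hm
  have h2 : firstEigenvalue Ω ≤ minimaxLevel Ω φ r :=
    hglb.2 fun _ hm => firstEigenvalue_le_of_mem_pathMaxima hΩ hφ hm
  rw [Real.dist_eq, abs_of_nonneg (by linarith)]
  linarith

end LogLaplacian

theorem mainTheorem11 (N : ℕ) (hN : 1 ≤ N) (Ω : Set (EuclideanSpace ℝ (Fin N)))
    (hΩ_open : IsOpen Ω) (hΩ_conn : IsConnected Ω) (hΩ_bdd : Bornology.IsBounded Ω)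
    (φ₁ : EuclideanSpace ℝ (Fin N) → ℝ) (hφ₁ : LogLaplacian.IsFirstEigenfunction Ω φ₁) :
    IsLeast ((fun u => LogLaplacian.logForm u u) '' LogLaplacian.unitSphere Ω)
      (LogLaplacian.firstEigenvalue Ω) ∧
    (∀ r : ℝ, 0 ≤ r →
      (∀ γ ∈ LogLaplacian.paths Ω φ₁, ∃ m : ℝ, IsGreatest (LogLaplacian.pathValues Ω r γ) m) ∧
      IsGLB (LogLaplacian.pathMaxima Ω φ₁ r) (LogLaplacian.minimaxLevel Ω φ₁ r)) ∧
    Tendsto (fun r : ℝ => LogLaplacian.minimaxLevel Ω φ₁ r) atTop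
      (𝓝 (LogLaplacian.firstEigenvalue Ω)) :=
  ⟨LogLaplacian.isLeast_firstEigenvalue hN hΩ_bdd hφ₁,
    fun r _ => ⟨fun _ hγ => LogLaplacian.exists_isGreatest_pathValues hN hΩ_bdd r hγ,
      LogLaplacian.isGLB_minimaxLevel hN hΩ_open hΩ_conn.nonempty hΩ_bdd hφ₁ r⟩,
    LogLaplacian.tendsto_minimaxLevel hN hΩ_open hΩ_conn.nonempty hΩ_bdd hφ₁⟩
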